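/- For $a\in\mathbb{C}$ and $n\in\mathbb{N}_0$ put $$c_n(a)=\frac1{2^n}\sum_{j=0}^{n}\binom nj\frac{(-1)^j}{(j+1)^a},\qquad f(s,a)=\frac{1-s}{\sum_{n=0}^{\infty}c_n(a)s^n},$$ and define the sequence $\hat b_0,\hat b_1,\ldots$ by $$\hat b_0=1,\quad \hat b_1=2^{-a-1}-2^{-1},\quad \hat b_n=c_{n-1}(a)-\sum_{l=0}^{n-1}\hat b_l\,c_{n-l}(a)\quad(n\ge 2).$$ Let $\hat\alpha_0(n)$, $n\in\mathbb{N}_0$, be the sequence given by $\hat\alpha_0(0)=1$ and $$\hat\alpha_0(n)=\frac1{\hat b_0}\Big(\hat\alpha_0(n-1)-\sum_{j=0}^{n-1}\hat b_{n-j}\,\hat\alpha_0(j)\Big),\qquad n\ge1 .$$ Let $\zeta$ be the Riemann zeta function, analytically continued to $\mathbb{C}\setminus\{1\}$. Suppose that $a\in\mathbb{C}$ is such that $f(s,a)$ is analytic in $|s|<1$ and $\lim_{s\to1^-}f(s,a)=0$. Then, with the sums of the series $\sum_j \hat b_j$ and $\sum_j j\hat b_j$ understood as $\lim_{s\to1^-}\sum_j\hat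 b_js^j$ and $\lim_{s\to1^-}\sum_j j\hat b_js^j$ (the power series converge for $|s|<1$ and both limits exist), $$\hat b_0+\hat b_1+\hat b_2+\cdots=1,\qquad \hat\alpha_0(n)=\sum_{k=0}^{n}\frac1{2^k}\sum_{j=0}^{k}\binom kj\frac{(-1)^j}{(j+1)^a}\quad(n\in\mathbb{N}_0),$$ $\sum_{j=1}^\infty j\hat b_j\neq1$, and, if $a\ne 1+\frac{2\pi i}{\log 2}n$ for all $n\in\mathbb{Z}$, then $2-2^{2-a}\neq 0$ and $$\zeta(a)=\frac1{2-2^{2-a}}\cdot\frac1{1-\sum_{j=1}^{\infty}j\,\hat b_j}.$$ If moreover $f(s,a)$ is analytic in the closed disc $|s|\le1$ (that is, at each of its points), then the series $\sum_j\hat b_j$ and $\sum_j j\hat b_j$ converge absolutely, and so have these sums in the ordinary sense. -/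

import Mathlib

noncomputable section

namespace RecurrentZeta

/-- `2⁻ⁿ ∑_{j=0}^{n} (n choose j) (-1)^j / (j+1)^a`. -/
def hasseTerm (a : ℂ) (n : ℕ) : ℂ :=
  1 / 2 ^ n * ∑ j ∈ Finset.range (n + 1), (n.choose j : ℂ) * ((-1) ^ j / ((j : ℂ) + 1) ^ a)

/-- The power series `∑ₙ 2⁻ⁿ ∑_{j=0}^{n} (n choose j) (-1)^j / (j+1)^a sⁿ`. -/
def hasseSeries (a s : ℂ) : ℂ := ∑' n : ℕ, hasseTerm a n * s ^ n

/-- `f(s, a)`, the quotient of `1 - s` by the power series above.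
At a zero `s ≠ 1` of the denominator Lean assigns the value `0`, but the quotient is unbounded
near such a point, so that it is not analytic there. -/
def f (s a : ℂ) : ℂ := (1 - s) / hasseSeries a s

/-- The sequence `b̂`. -/
def bHat (a : ℂ) : ℕ → ℂ
  | 0 => 1
  | 1 => 2 ^ (-a - 1) - 2⁻¹
  | n + 2 => hasseTerm a (n + 1) - ∑ l : Fin (n + 2), bHat a l * hasseTerm a (n + 2 - l)

/-- The sequence `α_k(n)`, `n = 0, 1, …`, attached to a sequence `b` and to integers `0 ≤ k < m`:
`α_k(n) = δ_{kn}` for `n < m`, and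
`α_k(n) = (α_k(n - m) - ∑_{j=0}^{n-1} b_{n-j} α_k(j)) / b_0` for `n ≥ m`.
(For `n = m` this gives `(1 - b_m) / b_0` if `k = 0` and `- b_{m-k} / b_0` if `k > 0`.
The meaningless case `m = 0` gets a default value.) -/
def alpha (b : ℕ → ℂ) (m k n : ℕ) : ℂ :=
  if n < m ∨ m = 0 then (if n = k then 1 else 0)
  else 1 / b 0 * (alpha b m k (n - m) - ∑ j : Fin n, b (n - j) * alpha b m k j)
termination_by n
decreasing_by
  · omega
  · exact j.isLt

/-- `u 0 + u 1 + u 2 + ⋯ = L` as a limit `s → 1⁻` of the power series `∑ u n sⁿ`, which has to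
converge in `|s| < 1`. -/
def HasAbelSum (u : ℕ → ℂ) (L : ℂ) : Prop :=
  (∀ s : ℂ, ‖s‖ < 1 → Summable fun n : ℕ => u n * s ^ n) ∧
    Filter.Tendsto (fun s : ℝ => ∑' n : ℕ, u n * (s : ℂ) ^ n) (nhdsWithin 1 (Set.Iio 1)) (nhds L)

end RecurrentZeta

end

/-!
Put `C(s) = hasseSeries a s`. The recursion for `b̂` says `(B̂ - X) C = 1 - X` in `ℂ⟦X⟧`, and that
for `α̂₀` says `(B̂ - X) A = 1`, so that `A = C / (1 - X)`: the coefficients of `A` are the partial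
sums of those of `C`.

The coefficients of `C` are `O(n ^ m / 2 ^ n)`, locally uniformly in `a`: for `0 < re a` the Gamma
integral bounds the alternating binomial sums, and each step from `a + 1` to `a` costs a factor `n`.
Hence `C` is analytic in `|s| < 2` and entire in `a`. For `1 < re a` its value at `s = 1` is the
Euler transform of twice `∑ (-1)ʲ (j + 1)⁻ᵃ`, and analytic continuation gives
`C(1) = (2 - 2 ^ (2 - a)) ζ(a)` for all `a ≠ 1`.

Analyticity of `f` excludes zeros of `C` at points other than `1`, and `f → 0` as `s → 1⁻` excludes
a zero at `1`. So `∑ b̂ₙ sⁿ = f(s, a) + s` in `|s| < 1`, and the right-hand side is analytic at `1`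
with value `1` and derivative `1 - 1 / C(1)`. If `C` has no zeros in the closed disc, then by
compactness it has none in a larger disc, and the radius of convergence exceeds `1`.
-/

open Filter Topology MeasureTheory Metric PowerSeries
open Finset hiding mk

namespace RecurrentZeta

section EulerTransform

variable {𝕜 : Type*} [RCLike 𝕜]

lemma hasSum_choose_mul_pow (j : ℕ) {r : 𝕜} (hr : ‖r‖ < 1) :
    HasSum (fun n : ℕ => (n.choose j : 𝕜) * r ^ n) (r ^ j / (1 - r) ^ (j + 1)) := by
  have hzero : ∑ n ∈ range j, (n.choose j : 𝕜) * r ^ n = 0 :=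
    sum_eq_zero fun n hn => by simp [Nat.choose_eq_zero_of_lt (mem_range.1 hn)]
  rw [← hasSum_nat_add_iff' j, hzero, sub_zero]
  convert! (hasSum_choose_mul_geometric_of_norm_lt_one j hr).mul_left (r ^ j) using 1
  · ext n
    ring
  · ring

lemma summable_choose_mul_pow_mul {r : 𝕜} (hr : ‖r‖ < 1) {x : ℕ → 𝕜}
    (hx : Summable fun j => (‖r‖ / (1 - ‖r‖)) ^ j * ‖x j‖) :
    Summable fun p : ℕ × ℕ => (p.2.choose p.1 : 𝕜) * r ^ p.2 * x p.1 := by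
  have hcol (j : ℕ) : HasSum (fun n : ℕ => ‖(n.choose j : 𝕜) * r ^ n * x j‖)
      (‖r‖ ^ j / (1 - ‖r‖) ^ (j + 1) * ‖x j‖) := by
    simpa using (hasSum_choose_mul_pow j (r := ‖r‖) (by simpa using hr)).mul_right ‖x j‖
  refine .of_norm ((summable_prod_of_nonneg fun _ => norm_nonneg _).2
    ⟨fun j => (hcol j).summable, ?_⟩)
  refine (hx.mul_left (1 - ‖r‖)⁻¹).congr fun j => ?_
  rw [(hcol j).tsum_eq, div_pow, pow_succ']
  field_simp

theorem hasSum_pow_mul_sum_choose_mul {r : 𝕜} (hr : ‖r‖ < 1) {x : ℕ → 𝕜}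
    (hx : Summable fun j => (‖r‖ / (1 - ‖r‖)) ^ j * ‖x j‖) :
    HasSum (fun n => r ^ n * ∑ j ∈ range (n + 1), (n.choose j : 𝕜) * x j)
      ((1 - r)⁻¹ * ∑' j, (r / (1 - r)) ^ j * x j) := by
  have hsum := (summable_choose_mul_pow_mul hr hx).hasSum
  have hrow (n : ℕ) : HasSum (fun j => (n.choose j : 𝕜) * r ^ n * x j)
      (r ^ n * ∑ j ∈ range (n + 1), (n.choose j : 𝕜) * x j) := by
    rw [mul_sum, sum_congr rfl fun j _ => mul_left_comm _ _ _]
    simp only [← mul_assoc]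
    refine hasSum_sum_of_ne_finset_zero fun j hj => ?_
    simp [Nat.choose_eq_zero_of_lt (show n < j by simpa using hj)]
  have hcol (j : ℕ) : HasSum (fun n => (n.choose j : 𝕜) * r ^ n * x j)
      ((1 - r)⁻¹ * ((r / (1 - r)) ^ j * x j)) := by
    convert! (hasSum_choose_mul_pow j hr).mul_right (x j) using 1
    rw [div_pow, pow_succ']
    field_simp
  rw [← tsum_mul_left, (hsum.prod_fiberwise hcol).tsum_eq]
  exact ((Equiv.prodComm ℕ ℕ).hasSum_iff.2 hsum).prod_fiberwise hrow

end EulerTransform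

section ConvergentPowerSeries

/-- The formal power series `p` converges to the function `h` at every point of the open disc of
radius `R` about `0`. This links algebra in `ℂ⟦X⟧` to identities between functions; it is vacuous
for `R ≤ 0`. -/
def HasSumOnBall (p : ℂ⟦X⟧) (R : ℝ) (h : ℂ → ℂ) : Prop :=
  ∀ s : ℂ, ‖s‖ < R → HasSum (fun n => coeff n p * s ^ n) (h s)

namespace HasSumOnBall

variable {p q r : ℂ⟦X⟧} {g h : ℂ → ℂ} {R : ℝ}

lemma mono {R' : ℝ} (hp : HasSumOnBall p R h) (hR : R' ≤ R) : HasSumOnBall p R' h :=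
  fun s hs => hp s (hs.trans_le hR)

protected lemma one (R : ℝ) : HasSumOnBall 1 R fun _ => 1 := by
  intro s _
  convert! hasSum_single (f := fun n => coeff n (1 : ℂ⟦X⟧) * s ^ n) 0 fun n hn => ?_ using 1
  · simp
  · simp [coeff_one, hn]

protected lemma X (R : ℝ) : HasSumOnBall X R fun s => s := by
  intro s _
  convert! hasSum_single (f := fun n => coeff n (X : ℂ⟦X⟧) * s ^ n) 1 fun n hn => ?_ using 1
  · simp
  · simp [coeff_X, hn]

lemma add (hp : HasSumOnBall p R g) (hq : HasSumOnBall q R h) :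
    HasSumOnBall (p + q) R fun s => g s + h s :=
  fun s hs => by simpa only [map_add, add_mul] using (hp s hs).add (hq s hs)

lemma sub (hp : HasSumOnBall p R g) (hq : HasSumOnBall q R h) :
    HasSumOnBall (p - q) R fun s => g s - h s :=
  fun s hs => by simpa only [map_sub, sub_mul] using (hp s hs).sub (hq s hs)

lemma mul (hp : HasSumOnBall p R g) (hq : HasSumOnBall q R h) :
    HasSumOnBall (p * q) R fun s => g s * h s := by
  intro s hs
  have hsum := hasSum_sum_range_mul_of_summable_norm (hp s hs).summable.norm
    (hq s hs).summable.norm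
  rw [(hp s hs).tsum_eq, (hq s hs).tsum_eq] at hsum
  convert! hsum using 2 with n
  rw [coeff_mul, sum_mul, Nat.sum_antidiagonal_eq_sum_range_succ_mk]
  refine sum_congr rfl fun k hk => ?_
  rw [mul_mul_mul_comm, ← pow_add, Nat.add_sub_cancel' (mem_range_succ_iff.1 hk)]

lemma hasFPowerSeriesOnBall (hp : HasSumOnBall p R h) (hR : 0 < R) :
    HasFPowerSeriesOnBall h (.ofScalars ℂ fun n => coeff n p) 0 (ENNReal.ofReal R) where
  r_le := by
    refine le_of_forall_lt_imp_le_of_dense fun ρ hρ => ?_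
    lift ρ to NNReal using hρ.ne_top
    have hρR : ‖((ρ : ℝ) : ℂ)‖ < R := by
      simpa using (ENNReal.lt_ofReal_iff_toReal_lt ENNReal.coe_ne_top).1 hρ
    refine FormalMultilinearSeries.le_radius_of_summable _ ?_
    simpa using (hp _ hρR).summable.norm
  r_pos := by simpa using hR
  hasSum {s} hs := by
    rw [eball_ofReal, mem_ball_zero_iff] at hs
    simpa [mul_comm] using hp s hs

lemma differentiableOn (hp : HasSumOnBall p R h) : DifferentiableOn ℂ h (ball 0 R) := by
  rcases le_or_gt R 0 with hR | hR
  · simp [ball_eq_empty.2 hR, differentiableOn_empty]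
  · simpa only [eball_ofReal] using (hp.hasFPowerSeriesOnBall hR).differentiableOn

lemma of_differentiableOn (hh : DifferentiableOn ℂ h (ball 0 R)) :
    HasSumOnBall (mk fun n => iteratedDeriv n h 0 / n.factorial) R h := by
  intro s hs
  convert! Complex.hasSum_taylorSeries_on_ball hh (mem_ball_zero_iff.2 hs) using 2 with n
  simp only [coeff_mk, sub_zero, smul_eq_mul]
  ring

lemma unique (hR : 0 < R) (hp : HasSumOnBall p R h) (hq : HasSumOnBall q R h) : p = q := by
  have heq := (hp.hasFPowerSeriesOnBall hR).hasFPowerSeriesAt.eq_formalMultilinearSeries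
    (hq.hasFPowerSeriesOnBall hR).hasFPowerSeriesAt
  ext n
  exact congrFun (FormalMultilinearSeries.ofScalars_series_injective ℂ ℂ heq) n

lemma derivative (hR : 0 < R) (hp : HasSumOnBall p R h) :
    HasSumOnBall (derivative ℂ p) R (deriv h) := by
  have htaylor := of_differentiableOn hp.differentiableOn
  convert! of_differentiableOn (hp.differentiableOn.deriv isOpen_ball) using 1
  ext n
  rw [hp.unique hR htaylor, coeff_derivative, coeff_mk, coeff_mk, ← iteratedDeriv_succ',
    Nat.factorial_succ, Nat.cast_mul, Nat.cast_succ]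
  field_simp

lemma of_mul_eq (hR : 0 < R) (hq : HasSumOnBall q R h) (hr : HasSumOnBall r R g)
    (hne : ∀ s : ℂ, ‖s‖ < R → h s ≠ 0) (hpq : p * q = r) :
    HasSumOnBall p R fun s => g s / h s := by
  have hdiv : DifferentiableOn ℂ (fun s => g s / h s) (ball 0 R) :=
    hr.differentiableOn.div hq.differentiableOn fun s hs => hne s (mem_ball_zero_iff.1 hs)
  have htaylor := of_differentiableOn hdiv
  have hmul : HasSumOnBall _ R g := fun s hs => by
    simpa only [div_mul_cancel₀ _ (hne s hs)] using htaylor.mul hq s hs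
  have hq0 : q ≠ 0 := by
    rintro rfl
    exact hne 0 (by simpa using hR) ((hq 0 (by simpa using hR)).unique (by simp))
  have hp : p = _ := mul_right_cancel₀ hq0 (hpq.trans (hr.unique hR hmul))
  rwa [hp]

end HasSumOnBall

end ConvergentPowerSeries

section Growth

/-- The alternating binomial sum `∑ⱼ (n choose j) (-1)ʲ / (j + 1)ᵃ`, that is, the coefficient
`hasseTerm a n` without its factor `2⁻ⁿ`. -/
noncomputable def altBinomSum (a : ℂ) (n : ℕ) : ℂ :=
  ∑ j ∈ range (n + 1), (n.choose j : ℂ) * ((-1) ^ j / ((j : ℂ) + 1) ^ a)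

lemma hasseTerm_eq (a : ℂ) (n : ℕ) : hasseTerm a n = 1 / 2 ^ n * altBinomSum a n := rfl

@[simp]
lemma altBinomSum_zero (a : ℂ) : altBinomSum a 0 = 1 := by simp [altBinomSum]

lemma integral_cpow_mul_exp_neg_natCast_add_one_mul {a : ℂ} (ha : 0 < a.re) (j : ℕ) :
    ∫ t in Set.Ioi (0 : ℝ), (t : ℂ) ^ (a - 1) * Complex.exp (-((j + 1) * t)) =
      Complex.Gamma a / ((j : ℂ) + 1) ^ a := by
  have h := Complex.integral_cpow_mul_exp_neg_mul_Ioi ha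
    (show 0 < (j : ℝ) + 1 by positivity)
  push_cast at h
  rw [h, one_div, Complex.inv_cpow, div_eq_inv_mul]
  exact_mod_cast Complex.natCast_arg (n := j + 1) ▸ Real.pi_pos.ne

lemma integrableOn_cpow_mul_exp_neg_natCast_add_one_mul {a : ℂ} (ha : 0 < a.re) (j : ℕ) :
    IntegrableOn (fun t : ℝ => (t : ℂ) ^ (a - 1) * Complex.exp (-((j + 1) * t)))
      (Set.Ioi 0) :=
  .of_integral_ne_zero <| by
    rw [integral_cpow_mul_exp_neg_natCast_add_one_mul ha]
    exact div_ne_zero (Complex.Gamma_ne_zero_of_re_pos ha)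
      (Complex.natCast_add_one_cpow_ne_zero j a)

lemma Gamma_mul_altBinomSum {a : ℂ} (ha : 0 < a.re) (n : ℕ) :
    Complex.Gamma a * altBinomSum a n = ∫ t in Set.Ioi (0 : ℝ),
      (t : ℂ) ^ (a - 1) * Complex.exp (-t) * (1 - Complex.exp (-t)) ^ n := by
  have hexpand (t : ℝ) :
      (t : ℂ) ^ (a - 1) * Complex.exp (-t) * (1 - Complex.exp (-t)) ^ n =
        ∑ j ∈ range (n + 1), ((n.choose j : ℂ) * (-1) ^ j) *
          ((t : ℂ) ^ (a - 1) * Complex.exp (-((j + 1) * t))) := by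
    rw [sub_eq_neg_add (1 : ℂ), add_pow, mul_sum]
    refine sum_congr rfl fun j _ => ?_
    rw [neg_pow, show -(((j : ℂ) + 1) * t) = (j : ℂ) * -t + -t by ring, Complex.exp_add,
      Complex.exp_nat_mul]
    ring
  simp_rw [hexpand]
  rw [integral_finsetSum _ fun j _ =>
    (integrableOn_cpow_mul_exp_neg_natCast_add_one_mul ha j).const_mul _, altBinomSum, mul_sum]
  refine sum_congr rfl fun j _ => ?_
  rw [integral_const_mul, integral_cpow_mul_exp_neg_natCast_add_one_mul ha]
  ring

lemma norm_one_sub_exp_neg_pow_le_one {t : ℝ} (ht : 0 ≤ t) (n : ℕ) :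
    ‖(1 - Complex.exp (-t)) ^ n‖ ≤ 1 := by
  rw [norm_pow]
  refine pow_le_one₀ (norm_nonneg _) ?_
  have hexp := Real.exp_le_one_iff.2 (neg_nonpos.2 ht)
  rw [← Complex.ofReal_neg, ← Complex.ofReal_exp, ← Complex.ofReal_one, ← Complex.ofReal_sub,
    Complex.norm_of_nonneg (sub_nonneg.2 hexp)]
  linarith [Real.exp_pos (-t)]

lemma norm_altBinomSum_le_of_re_pos {a : ℂ} (ha : 0 < a.re) (n : ℕ) :
    ‖altBinomSum a n‖ ≤ Real.Gamma a.re * ‖(Complex.Gamma a)⁻¹‖ := by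
  rw [norm_inv, ← div_eq_mul_inv,
    le_div_iff₀' (norm_pos_iff.2 (Complex.Gamma_ne_zero_of_re_pos ha)), ← norm_mul,
    Gamma_mul_altBinomSum ha, Real.Gamma_eq_integral ha]
  refine norm_integral_le_of_norm_le (Real.GammaIntegral_convergent ha) ?_
  filter_upwards [ae_restrict_mem measurableSet_Ioi] with t (ht : 0 < t)
  rw [norm_mul, norm_mul, Complex.norm_cpow_eq_rpow_re_of_pos ht, Complex.norm_exp,
    mul_comm (t ^ _)]
  exact mul_le_of_le_one_right (by positivity) (norm_one_sub_exp_neg_pow_le_one ht.le n)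

lemma altBinomSum_succ_eq (a : ℂ) (n : ℕ) :
    altBinomSum a (n + 1) =
      (n + 2) * altBinomSum (a + 1) (n + 1) - (n + 1) * altBinomSum (a + 1) n := by
  have hn : altBinomSum (a + 1) n = ∑ j ∈ range (n + 1 + 1),
      (n.choose j : ℂ) * ((-1) ^ j / ((j : ℂ) + 1) ^ (a + 1)) := by
    rw [sum_range_succ, altBinomSum]
    simp
  rw [hn, altBinomSum, altBinomSum, mul_sum, mul_sum, ← sum_sub_distrib]
  refine sum_congr rfl fun j hj => ?_
  have hchoose : (n.choose j : ℂ) * (n + 1) = (n + 1).choose j * (n + 1 - j) := by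
    have h := congrArg (Nat.cast : ℕ → ℂ) (Nat.choose_mul_succ_eq n j)
    push_cast [Nat.cast_sub (mem_range_succ_iff.1 hj)] at h
    exact h
  have hj0 : (j : ℂ) + 1 ≠ 0 := Nat.cast_add_one_ne_zero j
  have hcpow := Complex.natCast_add_one_cpow_ne_zero j a
  rw [Complex.cpow_add _ _ hj0, Complex.cpow_one]
  field_simp
  linear_combination hchoose

lemma norm_altBinomSum_le {m : ℕ} {a : ℂ} (ha : -(m : ℝ) < a.re) (n : ℕ) :
    ‖altBinomSum a n‖ ≤
      (2 * n + 1) ^ m * (Real.Gamma (a + m).re * ‖(Complex.Gamma (a + m))⁻¹‖) := by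
  induction m generalizing a n with
  | zero => simpa using norm_altBinomSum_le_of_re_pos (by simpa using ha) n
  | succ m ih =>
    have ha' : -(m : ℝ) < (a + 1).re := by
      rw [Complex.add_re, Complex.one_re]
      push_cast at ha
      linarith
    specialize ih ha'
    rw [Nat.cast_succ, add_comm (m : ℂ), ← add_assoc]
    set M := Real.Gamma (a + 1 + m).re * ‖(Complex.Gamma (a + 1 + m))⁻¹‖
    cases n with
    | zero => simpa using ih 0
    | succ n =>
      have hM : 0 ≤ M := by simpa using (norm_nonneg _).trans (ih 0)
      have hsucc : ‖altBinomSum (a + 1) (n + 1)‖ ≤ (2 * n + 3) ^ m * M := by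
        refine (ih (n + 1)).trans_eq ?_
        push_cast
        ring
      have hn : ‖altBinomSum (a + 1) n‖ ≤ (2 * n + 3) ^ m * M := by
        refine (ih n).trans ?_
        gcongr
        norm_num
      have hn1 : ‖(n : ℂ) + 1‖ = n + 1 := mod_cast Complex.norm_natCast (n + 1)
      have hn2 : ‖(n : ℂ) + 2‖ = n + 2 := mod_cast Complex.norm_natCast (n + 2)
      calc ‖altBinomSum a (n + 1)‖
          ≤ (n + 2) * ‖altBinomSum (a + 1) (n + 1)‖ + (n + 1) * ‖altBinomSum (a + 1) n‖ := by
            rw [altBinomSum_succ_eq, ← hn1, ← hn2, ← norm_mul, ← norm_mul]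
            exact norm_sub_le _ _
        _ ≤ (n + 2) * ((2 * n + 3) ^ m * M) + (n + 1) * ((2 * n + 3) ^ m * M) := by gcongr
        _ = (2 * (n + 1 : ℕ) + 1) ^ (m + 1) * M := by
            push_cast
            ring

lemma exists_eventually_norm_altBinomSum_le (a₀ : ℂ) :
    ∃ (m : ℕ) (M : ℝ), ∀ᶠ a in 𝓝 a₀, ∀ n : ℕ, ‖altBinomSum a n‖ ≤ (2 * n + 1) ^ m * M := by
  obtain ⟨m, hm⟩ := exists_nat_gt (-a₀.re)
  have hGamma : ContinuousAt
      (fun a : ℂ => Real.Gamma (a + m).re * ‖(Complex.Gamma (a + m))⁻¹‖) a₀ := by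
    refine .mul (.comp (f := fun a : ℂ => (a + m).re) (g := Real.Gamma) ?_ (by fun_prop)) ?_
    · have hpos : 0 < (a₀ + m).re := by simpa using by linarith
      exact (Real.differentiableOn_Gamma_Ioi.differentiableAt (Ioi_mem_nhds hpos)).continuousAt
    · exact (Complex.differentiable_one_div_Gamma.continuous.comp
        (continuous_add_const _)).norm.continuousAt
  have hre : ∀ᶠ a : ℂ in 𝓝 a₀, -(m : ℝ) < a.re :=
    Complex.continuous_re.continuousAt.eventually (Ioi_mem_nhds (by linarith))
  obtain ⟨M, hM⟩ := exists_gt (Real.Gamma (a₀ + m).re * ‖(Complex.Gamma (a₀ + m))⁻¹‖)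
  refine ⟨m, M, ?_⟩
  filter_upwards [hre, hGamma.eventually (Iic_mem_nhds hM)] with a ha hle n
  exact (norm_altBinomSum_le ha n).trans (mul_le_mul_of_nonneg_left hle (by positivity))

lemma summable_two_mul_add_one_pow_mul_geometric (m : ℕ) {ρ : ℝ} (hρ : ‖ρ‖ < 1) :
    Summable fun n : ℕ => (2 * (n : ℝ) + 1) ^ m * ρ ^ n := by
  simp only [add_pow, mul_pow, one_pow, mul_one, sum_mul]
  refine summable_sum fun k _ => ?_
  refine ((summable_pow_mul_geometric_of_norm_lt_one k hρ).mul_left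
    (2 ^ k * (m.choose k : ℝ))).congr fun n => ?_
  ring

end Growth

section HasseSeries

lemma norm_hasseTerm_mul_pow (a s : ℂ) (n : ℕ) :
    ‖hasseTerm a n * s ^ n‖ = ‖altBinomSum a n‖ * (‖s‖ / 2) ^ n := by
  rw [hasseTerm_eq]
  simp only [norm_mul, norm_div, norm_one, norm_pow, Complex.norm_ofNat, div_pow]
  ring

lemma norm_norm_div_two_lt_one {s : ℂ} (hs : ‖s‖ < 2) : ‖‖s‖ / 2‖ < 1 := by
  rw [Real.norm_of_nonneg (by positivity)]
  linarith

lemma hasSumOnBall_hasseTerm (a : ℂ) : HasSumOnBall (mk (hasseTerm a)) 2 (hasseSeries a) := by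
  intro s hs
  obtain ⟨m, M, hM⟩ := exists_eventually_norm_altBinomSum_le a
  simp only [coeff_mk]
  refine (Summable.of_norm_bounded ((summable_two_mul_add_one_pow_mul_geometric m
    (norm_norm_div_two_lt_one hs)).mul_left M) fun n => ?_).hasSum
  rw [norm_hasseTerm_mul_pow, ← mul_assoc, mul_comm M]
  gcongr
  exact hM.self_of_nhds n

lemma differentiable_hasseTerm (n : ℕ) : Differentiable ℂ fun a => hasseTerm a n := by
  refine .const_mul (.fun_sum fun j _ => .const_mul (.div (by fun_prop) (fun a => ?_)
    fun a => Complex.natCast_add_one_cpow_ne_zero j a) _) _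
  exact differentiableAt_id.const_cpow (.inl (Nat.cast_add_one_ne_zero j))

lemma differentiable_hasseSeries {s : ℂ} (hs : ‖s‖ < 2) :
    Differentiable ℂ fun a => hasseSeries a s := by
  intro a₀
  obtain ⟨m, M, hM⟩ := exists_eventually_norm_altBinomSum_le a₀
  obtain ⟨U, hU, hUo, ha₀⟩ := _root_.eventually_nhds_iff.1 hM
  refine (Complex.differentiableOn_tsum_of_summable_norm
    ((summable_two_mul_add_one_pow_mul_geometric m (norm_norm_div_two_lt_one hs)).mul_left M)
    (fun n => ((differentiable_hasseTerm n).mul_const _).differentiableOn) hUo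
    fun n a ha => ?_).differentiableAt (hUo.mem_nhds ha₀)
  rw [norm_hasseTerm_mul_pow, ← mul_assoc, mul_comm M]
  gcongr
  exact hU a ha n

@[simp]
lemma hasseSeries_zero (a : ℂ) : hasseSeries a 0 = 1 := by
  rw [hasseSeries, tsum_eq_single 0 fun n hn => by simp [hn]]
  simp [hasseTerm_eq]

end HasseSeries

section Zeta

lemma hasSum_neg_one_pow_mul {𝕜 : Type*} [RCLike 𝕜] {y : ℕ → 𝕜} {S T : 𝕜} (hy : HasSum y S)
    (hodd : HasSum (fun k => y (2 * k + 1)) T) :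
    HasSum (fun j => (-1) ^ j * y j) (S - 2 * T) := by
  have heven : HasSum (fun k => y (2 * k)) (S - T) := by
    have h := (hy.summable.comp_injective (mul_right_injective₀ (two_ne_zero (α := ℕ)))).hasSum
    rwa [hy.unique (h.even_add_odd hodd), add_sub_cancel_right]
  have halt := HasSum.even_add_odd (f := fun j => (-1) ^ j * y j)
    (by simpa only [pow_mul, neg_one_sq, one_pow, one_mul] using heven)
    (by simpa only [pow_add, pow_mul, neg_one_sq, one_pow, pow_one, one_mul, neg_one_mul]
      using hodd.neg)
  convert! halt using 1
  ring

lemma summable_one_div_nat_add_one_cpow {a : ℂ} (ha : 1 < a.re) :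
    Summable fun j : ℕ => 1 / ((j : ℂ) + 1) ^ a := by
  simpa using (summable_nat_add_iff 1).2 (Complex.summable_one_div_nat_cpow.2 ha)

lemma hasSum_one_div_even_cpow {a : ℂ} (ha : 1 < a.re) :
    HasSum (fun k : ℕ => 1 / (((2 * k + 1 : ℕ) : ℂ) + 1) ^ a) (2 ^ (-a) * riemannZeta a) := by
  rw [zeta_eq_tsum_one_div_nat_add_one_cpow ha]
  refine ((summable_one_div_nat_add_one_cpow ha).hasSum.mul_left _).congr_fun ?_
  intro k
  rw [show ((2 * k + 1 : ℕ) : ℂ) + 1 = (2 : ℕ) * (k + 1 : ℕ) by push_cast; ring,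
    Complex.natCast_mul_natCast_cpow, Complex.cpow_neg]
  push_cast
  field_simp

lemma hasSum_neg_one_pow_div_nat_add_one_cpow {a : ℂ} (ha : 1 < a.re) :
    HasSum (fun j : ℕ => (-1) ^ j / ((j : ℂ) + 1) ^ a) ((1 - 2 * 2 ^ (-a)) * riemannZeta a) := by
  have hzeta := (summable_one_div_nat_add_one_cpow ha).hasSum
  rw [← zeta_eq_tsum_one_div_nat_add_one_cpow ha] at hzeta
  have halt := hasSum_neg_one_pow_mul hzeta (hasSum_one_div_even_cpow ha)
  simp only [mul_one_div] at halt
  convert! halt using 1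
  ring

lemma two_cpow_two_sub (a : ℂ) : (2 : ℂ) ^ (2 - a) = 4 * 2 ^ (-a) := by
  rw [sub_eq_add_neg, Complex.cpow_add _ _ two_ne_zero]
  norm_num

lemma hasseSeries_one_of_one_lt_re {a : ℂ} (ha : 1 < a.re) :
    hasseSeries a 1 = (2 - 2 ^ (2 - a)) * riemannZeta a := by
  have halt := hasSum_neg_one_pow_div_nat_add_one_cpow ha
  have heuler := hasSum_pow_mul_sum_choose_mul (r := (1 / 2 : ℂ)) (by norm_num)
    (x := fun j : ℕ => (-1) ^ j / ((j : ℂ) + 1) ^ a) (by norm_num; simpa using halt.summable.norm)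
  norm_num [halt.tsum_eq] at heuler
  simp only [hasseSeries, hasseTerm, one_pow, mul_one]
  simp only [← one_div_pow]
  rw [heuler.tsum_eq, two_cpow_two_sub]
  ring

/-- Hasse's globally convergent series for `riemannZeta`, by analytic continuation in `a`. -/
theorem hasseSeries_one {a : ℂ} (ha : a ≠ 1) :
    hasseSeries a 1 = (2 - 2 ^ (2 - a)) * riemannZeta a := by
  have hleft : AnalyticOnNhd ℂ (fun a => hasseSeries a 1) {1}ᶜ :=
    (differentiable_hasseSeries (by norm_num)).differentiableOn.analyticOnNhd
      isOpen_compl_singleton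
  have hright : AnalyticOnNhd ℂ (fun a : ℂ => (2 - 2 ^ (2 - a)) * riemannZeta a) {1}ᶜ := by
    refine DifferentiableOn.analyticOnNhd (.mul (Differentiable.differentiableOn fun a => ?_)
      differentiableOn_riemannZeta) isOpen_compl_singleton
    exact (differentiableAt_const _).sub
      (((differentiableAt_const _).sub differentiableAt_id).const_cpow (.inl two_ne_zero))
  have hhalfPlane : {a : ℂ | 1 < a.re} ∈ 𝓝 (2 : ℂ) :=
    (isOpen_lt continuous_const Complex.continuous_re).mem_nhds (by norm_num)
  refine hleft.eqOn_of_preconnected_of_eventuallyEq hright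
    (isConnected_compl_singleton_of_one_lt_rank (by simp) 1).isPreconnected
    (z₀ := 2) (by norm_num) ?_ ha
  filter_upwards [hhalfPlane] with a ha using hasseSeries_one_of_one_lt_re ha

lemma two_sub_two_cpow_two_sub_eq_zero_iff {a : ℂ} :
    (2 : ℂ) - 2 ^ (2 - a) = 0 ↔
      ∃ n : ℤ, a = 1 + 2 * (Real.pi : ℂ) * Complex.I / (Real.log 2 : ℂ) * n := by
  have hlog : (Real.log 2 : ℂ) ≠ 0 := mod_cast (Real.log_pos one_lt_two).ne'
  have hexp : (2 : ℂ) = Complex.exp (Real.log 2) := by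
    rw [← Complex.ofReal_exp, Real.exp_log two_pos, Complex.ofReal_ofNat]
  rw [sub_eq_zero, Complex.cpow_def_of_ne_zero two_ne_zero, ← Complex.ofNat_log]
  nth_rw 1 [hexp]
  rw [Complex.exp_eq_exp_iff_exists_int]
  refine exists_congr fun n => ?_
  field_simp
  constructor <;> intro h <;> linear_combination h

end Zeta

section Recursion

lemma hasseTerm_zero (a : ℂ) : hasseTerm a 0 = 1 := by simp [hasseTerm_eq]

lemma hasseTerm_one (a : ℂ) : hasseTerm a 1 = 1 / 2 * (1 - 2 ^ (-a)) := by
  rw [hasseTerm, sum_range_succ, sum_range_one, Complex.cpow_neg]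
  norm_num
  ring

lemma mk_bHat_sub_X_mul_mk_hasseTerm (a : ℂ) :
    (mk (bHat a) - X) * mk (hasseTerm a) = 1 - X := by
  rw [sub_mul, sub_eq_iff_eq_add]
  ext n
  rw [coeff_mul, Nat.sum_antidiagonal_eq_sum_range_succ_mk]
  simp only [coeff_mk, map_add, map_sub]
  match n with
  | 0 => simp [bHat, hasseTerm_zero]
  | 1 =>
    rw [coeff_one, coeff_one_X, coeff_succ_X_mul]
    simp only [sum_range_succ, sum_range_zero, bHat, hasseTerm_zero, hasseTerm_one, coeff_mk,
      Nat.sub_zero, Nat.sub_self]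
    rw [sub_eq_add_neg (-a), Complex.cpow_add _ _ two_ne_zero, Complex.cpow_neg_one]
    norm_num
    ring
  | n + 2 =>
    rw [coeff_one, coeff_X, coeff_succ_X_mul, sum_range_succ]
    simp only [coeff_mk, bHat, Nat.sub_self, hasseTerm_zero]
    rw [Fin.sum_univ_eq_sum_range (fun l => bHat a l * hasseTerm a (n + 2 - l))]
    simp

lemma mk_sub_X_mul_mk_alpha {b : ℕ → ℂ} (hb : b 0 ≠ 0) :
    (mk b - X) * mk (alpha b 1 0) = C (b 0) := by
  rw [sub_mul, sub_eq_iff_eq_add]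
  ext n
  cases n with
  | zero => simp [alpha]
  | succ n =>
    rw [mul_comm, coeff_mul, Nat.sum_antidiagonal_eq_sum_range_succ_mk, map_add, coeff_succ_X_mul,
      sum_range_succ]
    simp only [coeff_mk, coeff_C, Nat.sub_self]
    rw [alpha, Fin.sum_univ_eq_sum_range (fun j => b (n + 1 - j) * alpha b 1 0 j)]
    simp [hb, mul_comm]

theorem alpha_bHat (a : ℂ) (n : ℕ) :
    alpha (bHat a) 1 0 n = ∑ k ∈ range (n + 1), hasseTerm a k := by
  have hgeom : (mk 1 : ℂ⟦X⟧) * (1 - X) = 1 := mk_one_mul_one_sub_eq_one ℂ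
  have halpha : (mk (bHat a) - X) * mk (alpha (bHat a) 1 0) = 1 := by
    simpa [bHat] using mk_sub_X_mul_mk_alpha (b := bHat a) (by simp [bHat])
  have hmk : mk (alpha (bHat a) 1 0) = mk (hasseTerm a) * mk 1 := by
    linear_combination mk 1 * (mk (hasseTerm a) * halpha) -
      mk 1 * mk (alpha (bHat a) 1 0) * mk_bHat_sub_X_mul_mk_hasseTerm a -
      mk (alpha (bHat a) 1 0) * hgeom
  have hcoeff := congrArg (coeff n) hmk
  rw [coeff_mul, Nat.sum_antidiagonal_eq_sum_range_succ_mk] at hcoeff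
  simpa using hcoeff

end Recursion

section Zeros

lemma ne_zero_of_continuousAt_div {E 𝕜 : Type*} [TopologicalSpace E] [Field 𝕜] [TopologicalSpace 𝕜]
    [ContinuousMul 𝕜] [T2Space 𝕜] {g h : E → 𝕜} {x : E} [(𝓝[≠] x).NeBot]
    (hg : ContinuousAt g x) (hh : ContinuousAt h x) (hdiv : ContinuousAt (fun z => g z / h z) x)
    (hgx : g x ≠ 0) (hne : ∀ᶠ z in 𝓝[≠] x, h z ≠ 0) : h x ≠ 0 := by
  have heq : g =ᶠ[𝓝 x] fun z => g z / h z * h z := by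
    refine (hg.eventuallyEq_nhds_iff_eventuallyEq_nhdsNE (hdiv.mul hh)).1 ?_
    filter_upwards [hne] with z hz using (div_mul_cancel₀ _ hz).symm
  intro hx
  exact hgx (by simpa [hx] using heq.eq_of_nhds)

lemma ne_zero_of_tendsto_sub_div {𝕜 : Type*} [NontriviallyNormedField 𝕜] {h : 𝕜 → 𝕜} {x : 𝕜}
    {l : Filter 𝕜} [l.NeBot] (hl : l ≤ 𝓝[≠] x) (hh : DifferentiableAt 𝕜 h x)
    (hne : ∀ᶠ z in l, h z ≠ 0) (hlim : Tendsto (fun z => (x - z) / h z) l (𝓝 0)) : h x ≠ 0 := by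
  intro hx
  have hmul := hlim.mul (hh.hasDerivAt.tendsto_slope.mono_left hl)
  rw [zero_mul] at hmul
  have hneg : Tendsto (fun _ => (-1 : 𝕜)) l (𝓝 0) := by
    refine hmul.congr' ?_
    filter_upwards [hne, hl self_mem_nhdsWithin] with z hz (hzx : z ≠ x)
    have := sub_ne_zero.2 hzx
    rw [slope_def_field, hx, sub_zero]
    field_simp
    ring
  simpa using tendsto_nhds_unique hneg tendsto_const_nhds

lemma analyticOnNhd_hasseSeries (a : ℂ) : AnalyticOnNhd ℂ (hasseSeries a) (ball 0 2) :=
  (hasSumOnBall_hasseTerm a).differentiableOn.analyticOnNhd isOpen_ball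

lemma analyticAt_hasseSeries_one (a : ℂ) : AnalyticAt ℂ (hasseSeries a) 1 :=
  analyticOnNhd_hasseSeries a 1 (by simp)

lemma hasseSeries_ne_zero_of_analyticAt {a s : ℂ} (hs : ‖s‖ < 2) (hs1 : s ≠ 1)
    (hf : AnalyticAt ℂ (fun s => f s a) s) : hasseSeries a s ≠ 0 := by
  have hball : s ∈ ball (0 : ℂ) 2 := mem_ball_zero_iff.2 hs
  have hana := analyticOnNhd_hasseSeries a
  refine ne_zero_of_continuousAt_div (g := fun z => 1 - z) (by fun_prop)
    (hana s hball).continuousAt hf.continuousAt (sub_ne_zero.2 hs1.symm) ?_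
  refine (hana s hball).eventually_eq_zero_or_eventually_ne_zero.resolve_left fun hzero => ?_
  simpa using hana.eqOn_zero_of_preconnected_of_eventuallyEq_zero
    (convex_ball (0 : ℂ) 2).isPreconnected hball hzero (mem_ball_self two_pos)

lemma tendsto_ofReal_nhdsLT_one : Tendsto (fun s : ℝ => (s : ℂ)) (𝓝[<] 1) (𝓝 1) :=
  mod_cast (Complex.continuous_ofReal.tendsto 1).mono_left nhdsWithin_le_nhds

lemma eventually_norm_ofReal_lt_one : ∀ᶠ s : ℝ in 𝓝[<] 1, ‖(s : ℂ)‖ < 1 := by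
  filter_upwards [Ioo_mem_nhdsLT (zero_lt_one' ℝ)] with s hs
  simpa [abs_of_pos hs.1] using hs.2

lemma hasseSeries_one_ne_zero {a : ℂ} (hne : ∀ s : ℂ, ‖s‖ < 1 → hasseSeries a s ≠ 0)
    (hlim : Tendsto (fun s : ℝ => f (s : ℂ) a) (𝓝[<] 1) (𝓝 0)) : hasseSeries a 1 ≠ 0 := by
  refine ne_zero_of_tendsto_sub_div (l := map (fun s : ℝ => (s : ℂ)) (𝓝[<] 1)) ?_
    (analyticAt_hasseSeries_one a).differentiableAt
    (eventually_norm_ofReal_lt_one.mono fun s hs => hne s hs) hlim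
  refine tendsto_nhdsWithin_iff.2 ⟨tendsto_ofReal_nhdsLT_one, ?_⟩
  filter_upwards [self_mem_nhdsWithin] with s (hs : s < 1)
  simpa using hs.ne

lemma exists_one_lt_forall_hasseSeries_ne_zero {a : ℂ}
    (hne : ∀ s : ℂ, ‖s‖ ≤ 1 → hasseSeries a s ≠ 0) :
    ∃ R : ℝ, 1 < R ∧ R ≤ 2 ∧ ∀ s : ℂ, ‖s‖ < R → hasseSeries a s ≠ 0 := by
  have hopen : IsOpen (ball (0 : ℂ) 2 ∩ hasseSeries a ⁻¹' {0}ᶜ) :=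
    (analyticOnNhd_hasseSeries a).continuousOn.isOpen_inter_preimage isOpen_ball
      isOpen_compl_singleton
  have hsub : closedBall (0 : ℂ) 1 ⊆ ball 0 2 ∩ hasseSeries a ⁻¹' {0}ᶜ := fun s hs =>
    ⟨closedBall_subset_ball one_lt_two hs, hne s (mem_closedBall_zero_iff.1 hs)⟩
  obtain ⟨δ, hδ, hthick⟩ :=
    (isCompact_closedBall (0 : ℂ) 1).exists_thickening_subset_open hopen hsub
  rw [thickening_closedBall hδ zero_le_one] at hthick
  refine ⟨min (δ + 1) 2, lt_min (by linarith) one_lt_two, min_le_right _ _, fun s hs => ?_⟩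
  exact (hthick (mem_ball_zero_iff.2 (hs.trans_le (min_le_left _ _)))).2

end Zeros

section Sums

lemma HasSumOnBall.nat_mul {u : ℕ → ℂ} {h : ℂ → ℂ} {R : ℝ} (hR : 0 < R)
    (hu : HasSumOnBall (mk u) R h) :
    HasSumOnBall (mk fun n => n * u n) R fun s => s * deriv h s := by
  have hmk : (mk fun n => n * u n) = X * PowerSeries.derivative ℂ (mk u) := by
    ext n
    cases n with
    | zero => simp
    | succ n => simp [coeff_succ_X_mul, coeff_derivative, mul_comm]
  rw [hmk]
  exact (HasSumOnBall.X R).mul (hu.derivative hR)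

lemma HasSumOnBall.hasAbelSum {u : ℕ → ℂ} {h : ℂ → ℂ} (hu : HasSumOnBall (mk u) 1 h)
    (hh : ContinuousAt h 1) : HasAbelSum u (h 1) := by
  have hsum (s : ℂ) (hs : ‖s‖ < 1) : HasSum (fun n => u n * s ^ n) (h s) := by
    simpa only [coeff_mk] using hu s hs
  refine ⟨fun s hs => (hsum s hs).summable, (hh.tendsto.comp tendsto_ofReal_nhdsLT_one).congr' ?_⟩
  filter_upwards [eventually_norm_ofReal_lt_one] with s hs using (hsum s hs).tsum_eq.symm

lemma hasSumOnBall_bHat {a : ℂ} {R : ℝ} (hR0 : 0 < R) (hR : R ≤ 2)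
    (hne : ∀ s : ℂ, ‖s‖ < R → hasseSeries a s ≠ 0) :
    HasSumOnBall (mk (bHat a)) R fun s => f s a + s := by
  have hquot : HasSumOnBall (mk (bHat a) - X) R fun s => f s a :=
    .of_mul_eq hR0 ((hasSumOnBall_hasseTerm a).mono hR) (.sub (.one R) (.X R)) hne
      (mk_bHat_sub_X_mul_mk_hasseTerm a)
  simpa only [sub_add_cancel] using hquot.add (.X R)

lemma f_one (a : ℂ) : f 1 a = 0 := by simp [f]

lemma analyticAt_f_add_self_one {a : ℂ} (h1 : hasseSeries a 1 ≠ 0) :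
    AnalyticAt ℂ (fun s => f s a + s) 1 :=
  ((analyticAt_const.sub analyticAt_id).div (analyticAt_hasseSeries_one a) h1).add analyticAt_id

lemma deriv_f_add_self_one {a : ℂ} (h1 : hasseSeries a 1 ≠ 0) :
    deriv (fun s => f s a + s) 1 = 1 - 1 / hasseSeries a 1 := by
  have hnum : HasDerivAt (fun s : ℂ => 1 - s) (-1) 1 := (hasDerivAt_id 1).const_sub 1
  have hden := (analyticAt_hasseSeries_one a).differentiableAt.hasDerivAt
  refine (((hnum.div hden h1).add (hasDerivAt_id 1)).congr_deriv ?_).deriv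
  field_simp
  ring

end Sums

end RecurrentZeta

theorem proposition3 (a : ℂ)
    (hf : AnalyticOnNhd ℂ (fun s : ℂ => RecurrentZeta.f s a) (Metric.ball 0 1))
    (hlim : Filter.Tendsto (fun s : ℝ => RecurrentZeta.f (s : ℂ) a)
      (nhdsWithin 1 (Set.Iio 1)) (nhds 0)) :
    RecurrentZeta.HasAbelSum (RecurrentZeta.bHat a) 1 ∧
    (∀ n : ℕ, RecurrentZeta.alpha (RecurrentZeta.bHat a) 1 0 n =
      ∑ k ∈ Finset.range (n + 1), 1 / 2 ^ k *
        ∑ j ∈ Finset.range (k + 1), (k.choose j : ℂ) * ((-1) ^ j / ((j : ℂ) + 1) ^ a)) ∧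
    ∃ L : ℂ,
      RecurrentZeta.HasAbelSum (fun j : ℕ => (j : ℂ) * RecurrentZeta.bHat a j) L ∧
      1 - L ≠ 0 ∧
      ((∀ n : ℤ, a ≠ 1 + 2 * (Real.pi : ℂ) * Complex.I / (Real.log 2 : ℂ) * (n : ℂ)) →
        (2 : ℂ) - 2 ^ (2 - a) ≠ 0 ∧
        riemannZeta a = 1 / (2 - 2 ^ (2 - a)) * (1 / (1 - L))) ∧
      (AnalyticOnNhd ℂ (fun s : ℂ => RecurrentZeta.f s a) (Metric.closedBall 0 1) →
        HasSum (RecurrentZeta.bHat a) 1 ∧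
        HasSum (fun j : ℕ => (j : ℂ) * RecurrentZeta.bHat a j) L) := by
  open RecurrentZeta in
  have hne (s : ℂ) (hs : ‖s‖ < 1) : hasseSeries a s ≠ 0 :=
    hasseSeries_ne_zero_of_analyticAt (hs.trans one_lt_two) (by rintro rfl; simp at hs)
      (hf s (mem_ball_zero_iff.2 hs))
  have hne1 : hasseSeries a 1 ≠ 0 := hasseSeries_one_ne_zero hne hlim
  have hana := analyticAt_f_add_self_one hne1
  have hsum := hasSumOnBall_bHat one_pos one_le_two hne
  refine ⟨by simpa [f_one] using hsum.hasAbelSum hana.continuousAt, alpha_bHat a,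
    1 - 1 / hasseSeries a 1, ?_, by simpa using hne1, fun ha => ?_, fun hf' => ?_⟩
  · simpa [deriv_f_add_self_one hne1] using
      (hsum.nat_mul one_pos).hasAbelSum (continuousAt_id.mul hana.deriv.continuousAt)
  · have htwo : (2 : ℂ) - 2 ^ (2 - a) ≠ 0 := by
      simpa [two_sub_two_cpow_two_sub_eq_zero_iff] using ha
    refine ⟨htwo, ?_⟩
    rw [sub_sub_cancel, one_div_one_div, hasseSeries_one (by simpa using ha 0), ← mul_assoc,
      one_div_mul_cancel htwo, one_mul]
  · obtain ⟨R, hR1, hR2, hneR⟩ := exists_one_lt_forall_hasseSeries_ne_zero fun s hs => by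
      rcases eq_or_ne s 1 with rfl | hs1
      · exact hne1
      · exact hasseSeries_ne_zero_of_analyticAt (hs.trans_lt one_lt_two) hs1
          (hf' s (mem_closedBall_zero_iff.2 hs))
    have hR0 := one_pos.trans hR1
    have hsumR := hasSumOnBall_bHat hR0 hR2 hneR
    exact ⟨by simpa [f_one] using hsumR 1 (by simpa using hR1),
      by simpa [deriv_f_add_self_one hne1] using hsumR.nat_mul hR0 1 (by simpa using hR1)⟩
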